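/- Let $R$ be a commutative Noetherian ring and let $\mathfrak a\subseteq R$ be a perfect ideal, i.e. a proper ideal such that $\operatorname{grade}(\mathfrak a)$, the maximal length of an $R$-regular sequence contained in $\mathfrak a$, equals the projective dimension of the $R$-module $R/\mathfrak a$. Assume that for every $k\in\mathbb N=\{0,1,2,\dots\}$ there is a ring homomorphism $\phi_k:R\to R$ such that: 1. $\phi_0=1_R$ is the identity of $R$; 2. $\phi_i(\mathfrak a)\subseteq\phi_j(\mathfrak a)$ whenever $i\ge j$; 3. the system of ideals $\{\phi_k(\mathfrak a)R\}_{k\in\mathbb N}$ is cofinal with $\{\mathfrak a^k\}_{k\in\mathbb N}$, i.e. for every $k$ there is an $l$ with $\mathfrak a^l\subseteq\phi_k(\mathfrak a)R$, and for every $k$ there is an $l$ with $\phi_l(\mathfrak a)R\subseteq\mathfrak a^k$. Then $\operatorname{cd}(R,\mathfrak a)=\operatorname{ht}(\mathfrak a)$, where $\operatorname{ht}(\mathfrak a)$ is the height of $\mathfrak a$ and $\operatorname{cd}(R,\mathfrak a)$, the cohomological dimension, is the least natural number $c$ such that the local cohomology modules $H^i_{\mathfrak a}(M)$ vanish for all $R$-modules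 $M$ and all $i>c$. -/

import Mathlib

universe u

/-- The grade of an ideal `a` of `R`: the supremum of the lengths of the `R`-regular sequences
all of whose entries lie in `a`. -/
noncomputable def Ideal.grade {R : Type u} [CommRing R] (a : Ideal R) : ℕ∞ :=
  ⨆ (rs : List R) (_ : RingTheory.Sequence.IsRegular R rs) (_ : ∀ r ∈ rs, r ∈ a),
    (rs.length : ℕ∞)

/-- An ideal `a` is perfect if `grade a` equals the projective dimension of `R ⧸ a`.
The zero module has projective dimension `⊥`, so a perfect ideal is proper. -/
def Ideal.IsPerfect {R : Type u} [CommRing R] (a : Ideal R) : Prop :=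
  CategoryTheory.projectiveDimension (ModuleCat.of R (R ⧸ a)) = (a.grade : WithBot ℕ∞)

/-- The cohomological dimension of an ideal `a`: the least natural number `c` such that the local
cohomology modules of every `R`-module `M` with support in `a` vanish in all degrees `i > c`
(and `⊤` if there is no such `c`). -/
noncomputable def Ideal.cohomologicalDimension {R : Type u} [CommRing R] (a : Ideal R) : ℕ∞ :=
  ⨅ (c : ℕ) (_ : ∀ (M : ModuleCat.{u} R) (i : ℕ), c < i →
    CategoryTheory.Limits.IsZero ((localCohomology a i).obj M)), (c : ℕ∞)

/-- Two families of ideals indexed by `ℕ` are cofinal with each other if every member of either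
family contains a member of the other one. -/
def Ideal.AreCofinal {R : Type u} [CommRing R] (I J : ℕ → Ideal R) : Prop :=
  (∀ k, ∃ l, J l ≤ I k) ∧ (∀ k, ∃ l, I l ≤ J k)

/-! ### Regular sequences and the vanishing of Ext -/

section ExtRegular

open CategoryTheory Abelian RingTheory.Sequence

variable {S : Type u} [CommRing S]

/-! Let `rs` be a regular sequence in `a` of length g = grade a = pd R/a; all three numbers cd, ht
and g turn out to agree.

Perfection survives base change: if aS contains powers of a weakly regular sequence of length g,
then pd S/aS ≤ g and Ext^g(S/aS, S) is faithful over S/aS, with no flatness assumed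
(`Ideal.quotient_map_of_isWeaklyRegular`). By cofinality this applies to every φ_k. In degrees above
g the transition maps Ext(R/a^k, M) → Ext(R/a^l, M) eventually factor through some Ext(R/φ_m(a)R, M)
= 0, so cd ≤ g. In degree g, pullback along R/a^l → R/a is injective on Ext(-, R), and Ext^g(R/a, R)
≠ 0 by faithfulness, so cd ≥ g.

Clearly g ≤ ht a. For the converse, localise at a minimal prime of `a` to get (A, m) and I_k =
φ_k(a)A, and put X = (rs), D_k = Ext^g(A/I_k, A). The socle of D_k comes from Ext^g(A/m, A), so it
has r generators with r independent of k; the X-torsion of D_k is killed by a fixed m^e. Matlis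
duality and Cayley–Hamilton turn this into c^r ∈ X + I_k for all c ∈ m^e and all k. By Krull's
intersection theorem c^r ∈ X, so X is m-primary and Krull's height theorem gives ht a ≤ g. -/

lemma CategoryTheory.Abelian.Ext.smul_eq_zero_of_forall_smul_eq_zero {T M : ModuleCat.{u} S} {n : ℕ}
    {x : S} (hx : ∀ t : T, x • t = 0) (e : Ext T M n) : x • e = 0 := by
  have h : x • 𝟙 T = 0 := by ext t; exact hx t
  have : (Ext.mk₀ (x • 𝟙 T)).comp e (zero_add n) = x • e := by simp [Ext.mk₀_smul]
  rw [← this, h]; simp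

lemma CategoryTheory.Abelian.Ext.comp_mk₀_smulShortComplex_f {T M : ModuleCat.{u} S} {n : ℕ}
    (x : S) (e : Ext T M n) :
    e.comp (Ext.mk₀ (M.smulShortComplex x).f) (add_zero n) = (x • e : Ext T M n) :=
  (Ext.smul_eq_comp_mk₀ e x).symm

/-- If `M` admits a weakly regular sequence of length `n` whose entries act nilpotently on `T`,
then `Ext T M i = 0` for all `i < n`. -/
lemma RingTheory.Sequence.IsWeaklyRegular.ext_eq_zero {T M : ModuleCat.{u} S} {rs : List S}
    (hrs : IsWeaklyRegular M rs) (hT : ∀ x ∈ rs, ∃ l : ℕ, ∀ t : T, x ^ l • t = 0) {i : ℕ}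
    (hi : i < rs.length) (e : Ext T M i) : e = 0 := by
  induction rs generalizing M i with
  | nil => simp at hi
  | cons x rs ih =>
    rw [isWeaklyRegular_cons_iff] at hrs
    obtain ⟨hx, hrs⟩ := hrs
    -- Multiplication by x is injective on Ext^i(T, M): its kernel is the image of Ext^(i-1)(T,
    -- M/xM), which vanishes by induction. It is also nilpotent.
    have key : ∀ e : Ext T M i, x • e = 0 → e = 0 := by
      intro e he
      have hS := hx.smulShortComplex_shortExact
      have he' : e.comp (Ext.mk₀ (M.smulShortComplex x).f) (add_zero i) = 0 :=
        (Ext.comp_mk₀_smulShortComplex_f x e).trans he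
      cases i with
      | zero =>
        have := hS.mono_f
        apply Ext.postcomp_mk₀_injective_of_mono T (M.smulShortComplex x).f
        exact he'.trans (map_zero _).symm
      | succ i =>
        obtain ⟨e₃, rfl⟩ := Ext.covariant_sequence_exact₁ T hS e he' rfl
        have : e₃ = 0 := ih (M := ModuleCat.of S (QuotSMulTop x M)) hrs
          (fun y hy => hT y (by simp [hy])) (by simpa using hi) e₃
        subst this
        exact (by simp : (0 : Ext T (M.smulShortComplex x).X₃ i).comp hS.extClass rfl = 0)
    obtain ⟨l, hl⟩ := hT x (by simp)
    have hl' : x ^ l • e = 0 := Ext.smul_eq_zero_of_forall_smul_eq_zero hl e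
    clear hl
    induction l with
    | zero => simpa using hl'
    | succ l ihl => exact ihl (key _ (by rw [smul_smul, ← pow_succ']; exact hl'))

/-- If `rs` is weakly regular on `M` and kills `T`, any scalar killing `Hom T (M ⧸ rs M)` also
kills `Ext T M n`, where `n` is the length of `rs`. -/
lemma RingTheory.Sequence.IsWeaklyRegular.smul_ext_eq_zero {T M : ModuleCat.{u} S} {rs : List S}
    (hrs : IsWeaklyRegular M rs) (hT : ∀ x ∈ rs, ∀ t : T, x • t = 0) {c : S}
    (hc : ∀ (f : T →ₗ[S] (M ⧸ (Ideal.ofList rs • ⊤ : Submodule S M))), c • f = 0)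
    (e : Ext T M rs.length) : c • e = 0 := by
  induction rs generalizing M with
  | nil =>
    obtain ⟨f, rfl⟩ := (Ext.mk₀_bijective T M).2 e
    rw [← Ext.mk₀_smul]
    have : c • f = 0 := by
      ext t
      have := LinearMap.congr_fun (hc ((Submodule.mkQ _).comp f.hom)) t
      simp only [LinearMap.smul_apply, LinearMap.comp_apply, Submodule.mkQ_apply,
        LinearMap.zero_apply, ← Submodule.Quotient.mk_smul, Submodule.Quotient.mk_eq_zero,
        Ideal.ofList_nil, Submodule.bot_smul, Submodule.mem_bot] at this
      exact this
    simp [this]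
  | cons x rs ih =>
    rw [isWeaklyRegular_cons_iff] at hrs
    obtain ⟨hx, hrs⟩ := hrs
    have hS := hx.smulShortComplex_shortExact
    have he' : e.comp (Ext.mk₀ (M.smulShortComplex x).f) (add_zero _) = 0 :=
      (Ext.comp_mk₀_smulShortComplex_f x e).trans <| Ext.smul_eq_zero_of_forall_smul_eq_zero (hT x (by simp)) e
    -- Since x kills e, the class comes from Ext(T, M/xM) one degree lower.
    obtain ⟨e₃, rfl⟩ := Ext.covariant_sequence_exact₁ T hS e he'
      (n₀ := rs.length) rfl
    have : c • e₃ = 0 := by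
      refine ih (M := ModuleCat.of S (QuotSMulTop x M)) hrs (fun y hy => hT y (by simp [hy])) ?_ e₃
      intro f
      let E := Submodule.quotOfListConsSMulTopEquivQuotSMulTopInner M x rs
      have := hc (E.symm.toLinearMap.comp f)
      ext t
      have := LinearMap.congr_fun this t
      apply E.symm.injective
      simpa using this
    exact (Ext.smul_comp e₃ hS.extClass rfl c).symm.trans (by rw [this, Ext.zero_comp]; rfl)

end ExtRegular

/-! ### Base change of perfection -/

section BaseChange

open CategoryTheory Abelian RingTheory.Sequence

open TensorProduct

/-- Multiplication by any element of `a` on `M` factors through every surjection onto `M`. -/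
def Ideal.FactorsThroughEpis {R : Type u} [CommRing R] (a : Ideal R) (M : Type u) [AddCommGroup M]
    [Module R M] : Prop :=
  ∀ r ∈ a, ∀ (F : Type u) [AddCommGroup F] [Module R F] (π : F →ₗ[R] M), Function.Surjective π →
    ∃ s : M →ₗ[R] F, π ∘ₗ s = r • LinearMap.id

lemma Ideal.factorsThroughEpis_quotient {R : Type u} [CommRing R] (a : Ideal R) :
    a.FactorsThroughEpis (R ⧸ a) := by
  intro r hr F _ _ π _
  refine ⟨0, ?_⟩
  ext
  simpa [Algebra.smul_def] using (Ideal.Quotient.eq_zero_iff_mem.mpr hr).symm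

/-- If π ∘ s = r, then r - s ∘ π lands in ker π and restricts there to multiplication by r. -/
lemma Ideal.FactorsThroughEpis.exists_retraction {R : Type u} [CommRing R] {a : Ideal R}
    {M F : Type u} [AddCommGroup M] [Module R M] [AddCommGroup F] [Module R F]
    (h : a.FactorsThroughEpis M) {π : F →ₗ[R] M} (hπ : Function.Surjective π) {r : R}
    (hr : r ∈ a) :
    ∃ t : F →ₗ[R] LinearMap.ker π, t ∘ₗ (LinearMap.ker π).subtype = r • LinearMap.id := by
  obtain ⟨s, hs⟩ := h r hr F π hπ
  have hker : ∀ x, (r • LinearMap.id - s ∘ₗ π : F →ₗ[R] F) x ∈ LinearMap.ker π := by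
    intro x
    have := LinearMap.congr_fun hs (π x)
    simp only [LinearMap.comp_apply, LinearMap.smul_apply, LinearMap.id_apply] at this
    simp [this]
  refine ⟨(r • LinearMap.id - s ∘ₗ π).codRestrict (LinearMap.ker π) hker, ?_⟩
  ext ⟨x, hx⟩
  simp [LinearMap.mem_ker.mp hx]

lemma Ideal.FactorsThroughEpis.ker {R : Type u} [CommRing R] {a : Ideal R} {M F : Type u}
    [AddCommGroup M] [Module R M] [AddCommGroup F] [Module R F] [Module.Projective R F]
    (h : a.FactorsThroughEpis M) {π : F →ₗ[R] M} (hπ : Function.Surjective π) :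
    a.FactorsThroughEpis (LinearMap.ker π) := by
  intro r hr F' _ _ π' hπ'
  obtain ⟨t, ht⟩ := h.exists_retraction hπ hr
  obtain ⟨u, hu⟩ := Module.projective_lifting_property π' t hπ'
  exact ⟨u ∘ₗ (LinearMap.ker π).subtype, by rw [← LinearMap.comp_assoc, hu, ht]⟩

lemma RingTheory.Sequence.IsWeaklyRegular.of_flat_module {S P : Type*} [CommRing S] [AddCommGroup P]
    [Module S P] [Module.Flat S P] {rs : List S} (hrs : IsWeaklyRegular S rs) :
    IsWeaklyRegular P rs :=
  ((TensorProduct.rid S P).isWeaklyRegular_congr rs).mp (hrs.isWeaklyRegular_lTensor (M₂ := P))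

/-- The identity of P is a finite sum of maps factoring through S. -/
lemma CategoryTheory.Abelian.Ext.smul_eq_zero_of_projective {S : Type u} [CommRing S]
    {T P : ModuleCat.{u} S} [Module.Finite S P] [Module.Projective S P] {n : ℕ} {c : S}
    (hc : ∀ e : Ext T (ModuleCat.of S S) n, c • e = 0) (e : Ext T P n) : c • e = 0 := by
  obtain ⟨k, f, g, -, -, hfg⟩ := Module.Finite.exists_comp_eq_id_of_projective S P
  have hid : 𝟙 P = ∑ i : Fin k, (ModuleCat.ofHom (LinearMap.proj i ∘ₗ g) : P ⟶ ModuleCat.of S S) ≫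
      ModuleCat.ofHom (f ∘ₗ LinearMap.single S (fun _ => S) i) := by
    ext x
    have h1 : f (g x) = x := LinearMap.congr_fun hfg x
    have h2 : g x = ∑ i, Pi.single i (g x i) := (Finset.univ_sum_single (g x)).symm
    rw [ModuleCat.hom_sum]
    simp only [ModuleCat.hom_id, LinearMap.id_coe, id_eq, ModuleCat.hom_comp, ModuleCat.hom_ofHom,
      LinearMap.sum_apply, LinearMap.comp_apply, LinearMap.proj_apply, LinearMap.single_apply]
    rw [← map_sum, ← h2, h1]
  rw [← Ext.comp_mk₀_id e, hid, Ext.mk₀_sum, Ext.comp_sum, Finset.smul_sum]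
  refine Finset.sum_eq_zero fun i _ => ?_
  rw [← Ext.mk₀_comp_mk₀, ← Ext.comp_assoc_of_second_deg_zero, ← Ext.smul_comp, hc, Ext.zero_comp]

variable {R S : Type u} [CommRing R] [CommRing S] [Algebra R S]

/-- Base change preserves the equation t ∘ ι = r. This is the substitute for flatness: the
obstruction Tor_1(S, M) is killed by aS. -/
lemma Ideal.FactorsThroughEpis.smul_eq_zero_of_mem_ker_baseChange {a : Ideal R}
    {M F : Type u} [AddCommGroup M] [Module R M] [AddCommGroup F] [Module R F]
    (h : a.FactorsThroughEpis M) {π : F →ₗ[R] M} (hπ : Function.Surjective π) {r : R}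
    (hr : r ∈ a) (u : S ⊗[R] LinearMap.ker π)
    (hu : (LinearMap.ker π).subtype.baseChange S u = 0) : algebraMap R S r • u = 0 := by
  obtain ⟨t, ht⟩ := h.exists_retraction hπ hr
  have h1 := LinearMap.congr_fun (congrArg (LinearMap.baseChange S) ht) u
  rw [LinearMap.baseChange_comp, LinearMap.comp_apply, hu, map_zero, LinearMap.baseChange_smul,
    LinearMap.baseChange_id] at h1
  rw [algebraMap_smul]
  simpa using h1.symm

lemma exact_baseChange_ker_subtype {M F : Type u} [AddCommGroup M] [Module R M] [AddCommGroup F]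
    [Module R F] {π : F →ₗ[R] M} (hπ : Function.Surjective π) :
    Function.Exact ((LinearMap.ker π).subtype.baseChange S) (π.baseChange S) := by
  have := lTensor_exact S (f := (LinearMap.ker π).subtype) (g := π)
    (LinearMap.exact_subtype_ker_map π) hπ
  exact this

/-- Base change of modules of finite projective dimension along `R → S`: if `S` has a weakly
regular sequence of length `n + j` in the radical of `aS`, and `a` acts on `M` by maps factoring
through all surjections, then `S ⊗ M` has projective dimension at most `n`, its first `j` groups
`Ext T (S ⊗ M) i` against modules `T` killed by `aS` vanish, and the scalars which kill
`Ext T S (n + j)` also kill `Ext T (S ⊗ M) j`. -/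
theorem Ideal.FactorsThroughEpis.baseChange [IsNoetherianRing R] {a : Ideal R} {rs : List S}
    (hrs : IsWeaklyRegular S rs) (hmem : ∀ x ∈ rs, ∃ l : ℕ, x ^ l ∈ a.map (algebraMap R S))
    (n j : ℕ) (hnj : rs.length = n + j) (M : Type u) [AddCommGroup M] [Module R M]
    [Module.Finite R M] (hM : HasProjectiveDimensionLE (ModuleCat.of R M) n)
    (h : a.FactorsThroughEpis M) :
    HasProjectiveDimensionLE (ModuleCat.of S (S ⊗[R] M)) n ∧
    ∀ T : ModuleCat.{u} S, (∀ r ∈ a.map (algebraMap R S), ∀ t : T, r • t = 0) →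
      (∀ i < j, ∀ e : Ext T (ModuleCat.of S (S ⊗[R] M)) i, e = 0) ∧
      ∀ c : S, (∀ e : Ext T (ModuleCat.of S S) (n + j), c • e = 0) →
        ∀ e : Ext T (ModuleCat.of S (S ⊗[R] M)) j, c • e = 0 := by
  have hproj : ∀ (P : ModuleCat.{u} S) [Module.Projective S P] (T : ModuleCat.{u} S),
      (∀ r ∈ a.map (algebraMap R S), ∀ t : T, r • t = 0) → ∀ i < rs.length,
      ∀ e : Ext T P i, e = 0 := by
    intro P _ T hT i hi e
    exact (hrs.of_flat_module (P := P)).ext_eq_zero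
      (fun x hx => (hmem x hx).imp fun l hl t => hT _ hl t) hi e
  induction n generalizing j M with
  | zero =>
    have : Projective (ModuleCat.of R M) := (projective_iff_hasProjectiveDimensionLE_zero _).mpr hM
    have : Module.Projective R M := (IsProjective.iff_projective M).mpr this
    refine ⟨?_, fun T hT => ⟨fun i hi => hproj _ T hT i (by omega), fun c hc e => ?_⟩⟩
    · exact (projective_iff_hasProjectiveDimensionLE_zero _).mp
        ((IsProjective.iff_projective (S ⊗[R] M)).mp inferInstance)
    · rw [zero_add] at hc
      exact Ext.smul_eq_zero_of_projective (P := ModuleCat.of S (S ⊗[R] M)) hc e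
  | succ n ih =>
    obtain ⟨F, _, _, _, _, π, hπ⟩ := Module.exists_finite_presentation R M
    have hS := LinearMap.shortExact_shortComplexKer hπ
    have hK : HasProjectiveDimensionLE (ModuleCat.of R (LinearMap.ker π)) n :=
      (hS.hasProjectiveDimensionLT_X₃_iff n inferInstance).mp hM
    -- Passing to the syzygy trades one unit of projective dimension for one more vanishing Ext
    -- group.
    obtain ⟨h1, h2⟩ := ih (j + 1) (by omega) (LinearMap.ker π) hK (h.ker hπ)
    set ι := (LinearMap.ker π).subtype.baseChange S with hι
    -- The kernel of ι is killed by aS, so its inclusion is an element of a vanishing Ext^0.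
    have hinj : Function.Injective ι := by
      rw [← LinearMap.ker_eq_bot]
      have hT : ∀ r ∈ a.map (algebraMap R S), ∀ t : LinearMap.ker ι, r • t = 0 := by
        intro r hr t
        have : a.map (algebraMap R S) ≤ (S ∙ t).annihilator := by
          rw [Ideal.map_le_iff_le_comap]
          intro r hr
          rw [Ideal.mem_comap, Submodule.mem_annihilator_span_singleton]
          exact Subtype.ext (h.smul_eq_zero_of_mem_ker_baseChange hπ hr t.1 t.2)
        exact Submodule.mem_annihilator_span_singleton _ _ |>.mp (this hr)
      have h0 := (h2 (ModuleCat.of S (LinearMap.ker ι)) hT).1 0 (by omega)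
        (Ext.mk₀ (ModuleCat.ofHom (LinearMap.ker ι).subtype))
      rw [← Ext.mk₀_zero, (Ext.mk₀_bijective _ _).1.eq_iff] at h0
      rw [eq_bot_iff]
      intro x hx
      exact LinearMap.congr_fun (ModuleCat.hom_ext_iff.mp h0) ⟨x, hx⟩
    have hex := exact_baseChange_ker_subtype (S := S) hπ
    have hS' : (ModuleCat.shortComplexOfCompEqZero ι (π.baseChange S)
        hex.linearMap_comp_eq_zero).ShortExact :=
      ModuleCat.shortComplex_shortExact _ hex hinj (LinearMap.lTensor_surjective S hπ)
    refine ⟨?_, fun T hT => ⟨fun i hi e => ?_, fun c hc e => ?_⟩⟩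
    · exact (hS'.hasProjectiveDimensionLT_X₃_iff n
        ((IsProjective.iff_projective (S ⊗[R] F)).mp inferInstance)).mpr h1
    · obtain ⟨e₂, rfl⟩ := Ext.covariant_sequence_exact₃ T hS' e rfl
        ((h2 T hT).1 (i + 1) (by omega) _)
      rw [hproj (ModuleCat.of S (S ⊗[R] F)) T hT i (by omega) e₂]
      exact Ext.zero_comp ..
    · have hc' := (h2 T hT).2 c (by rwa [show n + (j + 1) = n + 1 + j by omega])
        (e.comp hS'.extClass rfl)
      obtain ⟨e₂, he₂⟩ := Ext.covariant_sequence_exact₃ T hS' (c • e) rfl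
        ((Ext.smul_comp e hS'.extClass rfl c).trans hc')
      rw [← he₂, hproj (ModuleCat.of S (S ⊗[R] F)) T hT j (by omega) e₂]
      exact Ext.zero_comp ..

/-- A ring map `ψ : R → S` preserves the bound `n` on the projective dimension of `R ⧸ a` as soon
as the grade of `aS` is at least `n`; moreover `Ext (S ⧸ aS) S n` is then a faithful
`S ⧸ aS`-module. -/
theorem Ideal.quotient_map_of_isWeaklyRegular {R S : Type u} [CommRing R] [CommRing S]
    [IsNoetherianRing R] {a : Ideal R} (ψ : R →+* S) {rs : List S} (hrs : IsWeaklyRegular S rs)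
    (hmem : ∀ x ∈ rs, ∃ l : ℕ, x ^ l ∈ a.map ψ)
    (hpd : HasProjectiveDimensionLE (ModuleCat.of R (R ⧸ a)) rs.length) :
    HasProjectiveDimensionLE (ModuleCat.of S (S ⧸ a.map ψ)) rs.length ∧
    ∀ c : S, (∀ e : Ext (ModuleCat.of S (S ⧸ a.map ψ)) (ModuleCat.of S S) rs.length, c • e = 0) →
      c ∈ a.map ψ := by
  let := ψ.toAlgebra
  obtain ⟨h1, h2⟩ := (a.factorsThroughEpis_quotient).baseChange hrs hmem rs.length 0 rfl
    (R ⧸ a) hpd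
  let E : (S ⧸ a.map ψ) ≃ₗ[S] S ⊗[R] (R ⧸ a) :=
    (Algebra.TensorProduct.quotIdealMapEquivTensorQuot S a).toLinearEquiv
  refine ⟨hasProjectiveDimensionLT_of_iso E.symm.toModuleIso _, fun c hc => ?_⟩
  -- With j = 0, c kills the isomorphism E, regarded as an element of Ext^0.
  have := (h2 (ModuleCat.of S (S ⧸ a.map ψ)) (fun r hr t => ?_)).2 c hc
    (Ext.mk₀ (ModuleCat.ofHom E.toLinearMap))
  · rw [← Ext.mk₀_smul, ← Ext.mk₀_zero, (Ext.mk₀_bijective _ _).1.eq_iff] at this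
    have := LinearMap.congr_fun (ModuleCat.hom_ext_iff.mp this) (1 : S ⧸ a.map ψ)
    have h0 : c • E 1 = 0 := this
    rw [← map_smul, LinearEquiv.map_eq_zero_iff, Algebra.smul_def, mul_one] at h0
    exact Ideal.Quotient.eq_zero_iff_mem.mp h0
  · obtain ⟨t, rfl⟩ := Ideal.Quotient.mk_surjective t
    exact Ideal.Quotient.eq_zero_iff_mem.mpr (Ideal.mul_mem_right t _ hr)

end BaseChange

/-! ### Derived-functor Ext, `Abelian.Ext` and local cohomology -/

section ExtFunctor

open CategoryTheory Abelian RingTheory.Sequence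

open Opposite Limits

variable {R : Type u} [CommRing R]

/-- The map between complexes of linear maps into `Y` induced by a map of chain complexes. -/
noncomputable def ChainComplex.linearYonedaMap {K L : ChainComplex (ModuleCat.{u} R) ℕ} (φ : K ⟶ L)
    (Y : ModuleCat.{u} R) : L.linearYonedaObj R Y ⟶ K.linearYonedaObj R Y :=
  (HomologicalComplex.unopFunctor _ _).map
    ((((linearYoneda R (ModuleCat.{u} R)).obj Y).rightOp.mapHomologicalComplex _).map φ).op

lemma CategoryTheory.ProjectiveResolution.isoExt_inv_naturality {X X' : ModuleCat.{u} R}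
    (P : ProjectiveResolution X) (P' : ProjectiveResolution X') {g : X ⟶ X'}
    (φ : ProjectiveResolution.Hom P P' g) (n : ℕ) (Y : ModuleCat.{u} R) :
    (P'.isoExt n Y).inv ≫ ((Ext R (ModuleCat.{u} R) n).map g.op).app Y =
      HomologicalComplex.homologyMap (ChainComplex.linearYonedaMap φ.hom Y) n ≫
        (P.isoExt n Y).inv := by
  have h1 := P.isoLeftDerivedObj_hom_naturality g P' φ.hom φ.hom_f_zero_comp_π_f_zero
    ((linearYoneda R (ModuleCat.{u} R)).obj Y).rightOp n
  have h2 := HomologicalComplex.homologyOp_hom_naturality (ChainComplex.linearYonedaMap φ.hom Y) n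
  apply Quiver.Hom.op_inj
  exact ((CommSq.mk h1).vert_comp (CommSq.mk h2)).w

lemma ModuleCat.exists_toCycles_eq {K : CochainComplex (ModuleCat.{u} R) ℕ} {i j : ℕ}
    (hij : (ComplexShape.up ℕ).prev j = i) (z : K.cycles j) (hz : K.homologyπ j z = 0) :
    ∃ y : K.X i, K.toCycles i j y = z := by
  have h := ShortComplex.exact_of_g_is_cokernel
    (ShortComplex.mk (K.toCycles i j) (K.homologyπ j) (K.toCycles_comp_homologyπ i j))
    (K.homologyIsCokernel i j hij)
  rw [ShortComplex.moduleCat_exact_iff] at h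
  exact h z hz

lemma ModuleCat.exists_iCycles_eq {K : CochainComplex (ModuleCat.{u} R) ℕ} {i j : ℕ}
    (hij : (ComplexShape.up ℕ).next i = j) (x : K.X i) (hx : K.d i j x = 0) :
    ∃ z : K.cycles i, K.iCycles i z = x := by
  have h := ShortComplex.exact_of_f_is_kernel
    (ShortComplex.mk (K.iCycles i) (K.d i j) (K.iCycles_d i j))
    (K.cyclesIsKernel i j hij)
  rw [ShortComplex.moduleCat_exact_iff] at h
  exact h x hx

/-- Every class in `Abelian.Ext X' Y n` is represented by an element of the derived functor
`Ext`, in such a way that vanishing of pullbacks of the latter implies vanishing of pullbacks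
of the former. -/
lemma exists_ext_representative {X' Y : ModuleCat.{u} R} {n : ℕ} (e : Abelian.Ext X' Y n) :
    ∃ z : ((Ext R (ModuleCat.{u} R) n).obj (op X')).obj Y, ∀ {X : ModuleCat.{u} R} (g : X ⟶ X'),
      ((Ext R (ModuleCat.{u} R) n).map g.op).app Y z = 0 →
        (Abelian.Ext.mk₀ g).comp e (zero_add n) = 0 := by
  let P' := projectiveResolution X'
  obtain ⟨f, hf, rfl⟩ := P'.extMk_surjective e (n + 1) rfl
  obtain ⟨z, hz⟩ := ModuleCat.exists_iCycles_eq (K := P'.complex.linearYonedaObj R Y)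
    (CochainComplex.next ℕ n) f hf
  refine ⟨(P'.isoExt n Y).inv ((P'.complex.linearYonedaObj R Y).homologyπ n z), ?_⟩
  intro X g hg
  let P := projectiveResolution X
  let φ : ProjectiveResolution.Hom P P' g :=
    ⟨ProjectiveResolution.lift g P P', by simpa using ProjectiveResolution.lift_commutes_zero g P P'⟩
  rw [ProjectiveResolution.mk₀_comp_extMk f (n + 1) rfl hf φ]
  let ψ := ChainComplex.linearYonedaMap φ.hom Y
  have h1 : (P.complex.linearYonedaObj R Y).homologyπ n
      (HomologicalComplex.cyclesMap ψ n z) = 0 := by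
    have h2 := ConcreteCategory.congr_hom (P.isoExt_inv_naturality P' φ n Y)
      ((P'.complex.linearYonedaObj R Y).homologyπ n z)
    simp only [ConcreteCategory.comp_apply] at h2
    rw [hg] at h2
    have h3 := ConcreteCategory.congr_hom (HomologicalComplex.homologyπ_naturality ψ n) z
    simp only [ConcreteCategory.comp_apply] at h3
    rw [← h3]
    have h4 : Function.Injective (P.isoExt (R := R) n Y).inv :=
      (ConcreteCategory.bijective_of_isIso (P.isoExt (R := R) n Y).inv).1
    exact h4 (h2.symm.trans (map_zero _).symm)
  obtain ⟨i, hi⟩ : ∃ i, (ComplexShape.up ℕ).prev n = i := ⟨_, rfl⟩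
  obtain ⟨y, hy⟩ := ModuleCat.exists_toCycles_eq hi _ h1
  have h5 : (P.complex.linearYonedaObj R Y).d i n y =
      (φ.hom.f n ≫ f : P.complex.X n ⟶ Y) := by
    have h6 := congrArg ((P.complex.linearYonedaObj R Y).iCycles n) hy
    rw [← ConcreteCategory.comp_apply, HomologicalComplex.toCycles_i,
      ← ConcreteCategory.comp_apply, HomologicalComplex.cyclesMap_i,
      ConcreteCategory.comp_apply, hz] at h6
    exact h6
  cases n with
  | zero =>
    have h6 : (P.complex.linearYonedaObj R Y).d i 0 = 0 :=
      HomologicalComplex.shape _ _ _ (by simp)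
    rw [h6] at h5
    simp only [← h5]
    exact ProjectiveResolution.extMk_zero ..
  | succ n =>
    rw [P.extMk_eq_zero_iff _ _ _ _ n rfl]
    obtain rfl : n = i := by rw [← hi]; simp
    exact ⟨y, h5⟩

lemma isZero_ext_of_subsingleton {X Y : ModuleCat.{u} R} {n : ℕ}
    [Subsingleton (Abelian.Ext X Y (n + 1))] :
    IsZero (((Ext R (ModuleCat.{u} R) (n + 1)).obj (op X)).obj Y) := by
  let P := projectiveResolution X
  refine IsZero.of_iso ?_ (P.isoExt (n + 1) Y)
  rw [← HomologicalComplex.exactAt_iff_isZero_homology,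
    HomologicalComplex.exactAt_iff' _ n (n + 1) (n + 2) (by simp) (by simp),
    ShortComplex.moduleCat_exact_iff]
  intro f hf
  exact (P.extMk_eq_zero_iff f (n + 2) rfl hf n rfl).mp (Subsingleton.elim _ _)

/-- If every transition map out of `Ext (R ⧸ a ^ k) M i` eventually vanishes, then so does the
`i`-th local cohomology of `M`. -/
lemma isZero_localCohomology (a : Ideal R) (M : ModuleCat.{u} R) (i : ℕ)
    (h : ∀ k : ℕ, ∃ (l : ℕ) (hkl : k ≤ l),
      ((Ext R (ModuleCat.{u} R) i).map (ModuleCat.ofHom (Submodule.factor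
        (Ideal.pow_le_pow_right hkl : a ^ l ≤ a ^ k))).op).app M = 0) :
    IsZero ((localCohomology a i).obj M) := by
  let F := localCohomology.diagram (localCohomology.idealPowersDiagram a) i
  refine IsZero.of_iso ?_ (colimitObjIsoColimitCompEvaluation F M)
  rw [IsZero.iff_id_eq_zero]
  refine colimit.hom_ext fun k => ?_
  obtain ⟨l, hkl, hl⟩ := h k.unop.unop
  have : (F ⋙ (evaluation _ _).obj M).map ((homOfLE hkl).op.op : k ⟶ op (op l)) = 0 := hl
  rw [← colimit.w _ ((homOfLE hkl).op.op : k ⟶ op (op l)), this]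
  simp

/-- An element that vanishes in a filtered colimit of modules already dies at a finite stage. -/
lemma exists_comp_eq_zero_of_isZero_localCohomology (a : Ideal R) (M : ModuleCat.{u} R) (i : ℕ)
    (h : IsZero ((localCohomology a i).obj M)) (k : ℕ)
    (e : Abelian.Ext (ModuleCat.of R (R ⧸ a ^ k)) M i) :
    ∃ (l : ℕ) (hkl : k ≤ l), (Abelian.Ext.mk₀ (ModuleCat.ofHom (Submodule.factor
        (Ideal.pow_le_pow_right hkl : a ^ l ≤ a ^ k)))).comp e (zero_add i) = 0 := by
  obtain ⟨z, hz⟩ := exists_ext_representative e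
  let F := localCohomology.diagram (localCohomology.idealPowersDiagram a) i
  have h0 : IsZero (colimit (F ⋙ (evaluation _ _).obj M)) :=
    h.of_iso (colimitObjIsoColimitCompEvaluation F M).symm
  have : PreservesFilteredColimitsOfSize.{0, 0} (forget (ModuleCat.{u} R)) :=
    preservesFilteredColimitsOfSize_shrink.{0, u, 0, u} _
  obtain ⟨l, f, hf⟩ := Concrete.colimit_rep_eq_zero R (F ⋙ (evaluation _ _).obj M) (op (op k)) z
    (by rw [h0.eq_of_tgt (colimit.ι (F ⋙ (evaluation _ _).obj M) (op (op k))) 0]; rfl)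
  exact ⟨l.unop.unop, f.unop.unop.down.down, hz _ hf⟩

end ExtFunctor

/-! ### Injective hulls -/

section InjectiveHull

open CategoryTheory Abelian RingTheory.Sequence

variable {A : Type u} [CommRing A]

lemma Module.Injective.of_retract {E Q : Type u} [AddCommGroup E] [Module A E] [AddCommGroup Q]
    [Module A Q] [Module.Injective A Q] (i : E →ₗ[A] Q) (p : Q →ₗ[A] E) (h : p ∘ₗ i = .id) :
    Module.Injective A E where
  out X Y _ _ _ _ f hf g := by
    obtain ⟨t, ht⟩ := Module.Injective.out (R := A) f hf (i ∘ₗ g)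
    refine ⟨p ∘ₗ t, fun x => ?_⟩
    rw [LinearMap.comp_apply, ht]
    exact LinearMap.congr_fun h (g x)

/-- Inside an injective module, every submodule has an injective essential extension. -/
theorem Submodule.exists_injective_essential {Q : Type u} [AddCommGroup Q] [Module A Q]
    [Module.Injective A Q] (K : Submodule A Q) :
    ∃ E : Submodule A Q, K ≤ E ∧ Module.Injective A E ∧ ∀ N ≤ E, Disjoint N K → N = ⊥ := by
  obtain ⟨E, hKE, hE⟩ := zorn_le_nonempty₀
    {E : Submodule A Q | K ≤ E ∧ ∀ N ≤ E, Disjoint N K → N = ⊥} (fun c hc hchain y hy => by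
      refine ⟨sSup c, ⟨(hc hy).1.trans (le_sSup hy), fun N hN hNK => ?_⟩, fun z hz => le_sSup hz⟩
      rw [eq_bot_iff]
      intro x hx
      obtain ⟨F, hF, hxF⟩ := (Submodule.mem_sSup_of_directed ⟨y, hy⟩ hchain.directedOn).mp (hN hx)
      have := (hc hF).2 (A ∙ x) ((Submodule.span_singleton_le_iff_mem _ _).mpr hxF)
        (hNK.mono_left ((Submodule.span_singleton_le_iff_mem _ _).mpr hx))
      exact (Submodule.mem_bot A).mpr (Submodule.span_singleton_eq_bot.mp this)) K
    ⟨le_rfl, fun N hN hNK => by rwa [disjoint_iff, inf_eq_left.mpr hN] at hNK⟩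
  obtain ⟨U, -, hU⟩ := zorn_le_nonempty₀ {U : Submodule A Q | Disjoint U E}
    (fun c hc hchain y hy => by
      refine ⟨sSup c, ?_, fun z hz => le_sSup hz⟩
      rw [Set.mem_ofPred_eq, Submodule.disjoint_def]
      intro x hx hxE
      obtain ⟨F, hF, hxF⟩ := (Submodule.mem_sSup_of_directed ⟨y, hy⟩ hchain.directedOn).mp hx
      exact Submodule.disjoint_def.mp (hc hF) x hxF hxE) ⊥ disjoint_bot_left
  have hUE : Disjoint U E := hU.prop
  obtain ⟨t, ht⟩ := Module.Injective.out (R := A) (U.mkQ ∘ₗ E.subtype)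
    (by
      rw [← LinearMap.ker_eq_bot, eq_bot_iff]
      rintro ⟨x, hx⟩ hxU
      have hxU' : x ∈ U := by simpa using hxU
      simpa using Submodule.disjoint_def.mp hUE x hxU' hx) E.subtype
  replace ht : ∀ x ∈ E, t (U.mkQ x) = x := fun x hx => ht ⟨x, hx⟩
  -- The range contains E and, as U is a maximal complement of E, is still essential over K.
  -- Maximality of E makes it equal to E, so E is a retract of Q.
  have hWE : LinearMap.range (t ∘ₗ U.mkQ) ≤ E := by
    refine hE.le_of_ge ⟨hKE.trans fun x hx => ⟨x, ht x hx⟩, fun N hN hNK => ?_⟩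
      fun x hx => ⟨x, ht x hx⟩
    have h1 : Disjoint (N.comap (t ∘ₗ U.mkQ)) E := by
      rw [Submodule.disjoint_def]
      intro x hx hxE
      have hxN : x ∈ N := by
        have : t (U.mkQ x) ∈ N := hx
        rwa [ht x hxE] at this
      have := hE.prop.2 (N ⊓ E) inf_le_right (hNK.mono_left inf_le_left)
      exact (Submodule.mem_bot A).mp (this ▸ ⟨hxN, hxE⟩)
    have h2 : N.comap (t ∘ₗ U.mkQ) ≤ U := hU.le_of_ge h1 fun x hx => by
      have : U.mkQ x = 0 := by simpa using hx
      simp [this]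
    rw [eq_bot_iff]
    intro x hx
    obtain ⟨y, rfl⟩ := hN hx
    have : U.mkQ y = 0 := by simpa using h2 hx
    simp [this]
  refine ⟨E, hE.prop.1, ?_, hE.prop.2⟩
  refine Module.Injective.of_retract E.subtype
    ((t ∘ₗ U.mkQ).codRestrict E fun x => hWE ⟨x, rfl⟩) ?_
  ext ⟨x, hx⟩
  exact ht x hx

/-- The injective hull of the residue field of a local ring. -/
theorem IsLocalRing.exists_injective_hull_residueField (A : Type u) [CommRing A] [IsLocalRing A] :
    ∃ (E : Type u) (_ : AddCommGroup E) (_ : Module A E) (ε : E), Module.Injective A E ∧ ε ≠ 0 ∧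
      (∀ a ∈ maximalIdeal A, a • ε = 0) ∧
      ∀ e : E, (∀ a ∈ maximalIdeal A, a • e = 0) → e ∈ A ∙ ε := by
  let Q := Injective.under (ModuleCat.of A (A ⧸ maximalIdeal A))
  let i : (A ⧸ maximalIdeal A) →ₗ[A] Q := (Injective.ι (ModuleCat.of A (A ⧸ maximalIdeal A))).hom
  have hi : Function.Injective i := (ModuleCat.mono_iff_injective _).mp inferInstance
  have hQ : Injective (ModuleCat.of A Q) :=
    Injective.injective_under (ModuleCat.of A (A ⧸ maximalIdeal A))
  have : Module.Injective A Q := Module.injective_module_of_injective_object A Q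
  obtain ⟨E, hE, hinj, hess⟩ := Submodule.exists_injective_essential (LinearMap.range i)
  have hann : ∀ a ∈ maximalIdeal A, a • i 1 = 0 := fun a ha => by
    rw [← map_smul, Algebra.smul_def, mul_one]
    exact (congrArg i (Ideal.Quotient.eq_zero_iff_mem.mpr ha)).trans (map_zero i)
  refine ⟨E, inferInstance, inferInstance, ⟨i 1, hE ⟨1, rfl⟩⟩, hinj, ?_, ?_, ?_⟩
  · intro h
    have : i 1 = i 0 := (congrArg Subtype.val h).trans (map_zero i).symm
    exact one_ne_zero (hi this)
  · exact fun a ha => Subtype.ext (hann a ha)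
  · rintro ⟨e, he⟩ hm
    by_cases h0 : e = 0
    · subst h0; exact Submodule.zero_mem _
    have hnd : ¬ Disjoint (A ∙ e) (LinearMap.range i) := fun hd =>
      h0 (Submodule.span_singleton_eq_bot.mp
        (hess _ ((Submodule.span_singleton_le_iff_mem _ _).mpr he) hd))
    rw [Submodule.disjoint_def] at hnd
    push Not at hnd
    obtain ⟨x, hx, ⟨y, rfl⟩, hx0⟩ := hnd
    obtain ⟨a, ha⟩ := Submodule.mem_span_singleton.mp hx
    obtain ⟨b, rfl⟩ := Ideal.Quotient.mk_surjective y
    have hau : IsUnit a := by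
      by_contra hau
      have : a • e = 0 := congrArg Subtype.val (hm a ((mem_maximalIdeal a).mpr hau))
      exact hx0 (ha.symm.trans this)
    obtain ⟨v, rfl⟩ := hau
    refine Submodule.mem_span_singleton.mpr ⟨(↑v⁻¹ : A) * b, Subtype.ext ?_⟩
    change ((↑v⁻¹ : A) * b) • i 1 = e
    have hb : b • i 1 = v • e := by
      rw [← map_smul, Algebra.smul_def, mul_one]
      exact ha.symm
    rw [mul_smul, hb]
    exact inv_smul_smul v e

end InjectiveHull

/-! ### Matlis duality and Cayley–Hamilton -/

section Matlis

open CategoryTheory Abelian RingTheory.Sequence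

variable {A : Type u} [CommRing A] {D E : Type u} [AddCommGroup D] [Module A D] [AddCommGroup E]
  [Module A E]

/-- A map into an injective module which vanishes on the `J`-torsion is a `J`-linear combination
of maps. -/
lemma Module.Injective.mem_smul_top_of_vanish [Module.Injective A E] {J : Ideal A} (hJ : J.FG)
    (f : D →ₗ[A] E) (hf : ∀ d : D, (∀ j ∈ J, j • d = 0) → f d = 0) :
    f ∈ J • (⊤ : Submodule A (D →ₗ[A] E)) := by
  classical
  obtain ⟨s, rfl⟩ := hJ
  -- The kernel of μ is the J-torsion, so f factors through the image of μ and extends to the whole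
  -- power of D.
  let μ : D →ₗ[A] (s → D) := LinearMap.pi fun j => (j : A) • LinearMap.id
  have hker : LinearMap.ker μ ≤ LinearMap.ker f := by
    intro d hd
    refine hf d fun j hj => ?_
    have hs : Ideal.span (s : Set A) ≤ LinearMap.ker (LinearMap.toSpanSingleton A D d) := by
      rw [Ideal.span_le]
      exact fun j hj => congrFun (LinearMap.mem_ker.mp hd) ⟨j, hj⟩
    exact hs hj
  obtain ⟨g, hg⟩ := Module.Injective.out (R := A) ((LinearMap.ker μ).liftQ μ le_rfl)
    (LinearMap.ker_eq_bot.mp (Submodule.ker_liftQ_eq_bot _ _ _ le_rfl))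
    ((LinearMap.ker μ).liftQ f hker)
  have hfg : f = ∑ j : s, (j : A) • (g ∘ₗ LinearMap.single A (fun _ => D) j) := by
    ext d
    have h1 : g (μ d) = f d := by simpa using hg (Submodule.Quotient.mk d)
    rw [← h1, ← Finset.univ_sum_single (μ d), map_sum, LinearMap.sum_apply]
    refine Finset.sum_congr rfl fun j _ => ?_
    rw [LinearMap.smul_apply, ← map_smul]
    rfl
  rw [hfg]
  exact Submodule.sum_mem _ fun j _ =>
    Submodule.smul_mem_smul (Ideal.subset_span j.2) Submodule.mem_top

variable [IsLocalRing A]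

open IsLocalRing

lemma Module.Injective.exists_apply_eq [Module.Injective A E] {ε : E}
    (hε : ∀ a ∈ maximalIdeal A, a • ε = 0) {d : D} (hd : d ≠ 0) : ∃ f : D →ₗ[A] E, f d = ε := by
  let μ := LinearMap.toSpanSingleton A D d
  have hker : LinearMap.ker μ ≤ LinearMap.ker (LinearMap.toSpanSingleton A E ε) := by
    intro a ha
    refine hε a ((mem_maximalIdeal a).mpr fun hu => hd ?_)
    have : a • d = 0 := ha
    exact (hu.smul_eq_zero).mp this
  obtain ⟨g, hg⟩ := Module.Injective.out (R := A) ((LinearMap.ker μ).liftQ μ le_rfl)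
    (LinearMap.ker_eq_bot.mp (Submodule.ker_liftQ_eq_bot _ _ _ le_rfl))
    ((LinearMap.ker μ).liftQ _ hker)
  refine ⟨g, ?_⟩
  have h1 := hg (Submodule.Quotient.mk (1 : A))
  rwa [Submodule.liftQ_apply, Submodule.liftQ_apply, LinearMap.toSpanSingleton_apply,
    LinearMap.toSpanSingleton_apply, one_smul, one_smul] at h1

/-- The Matlis dual of a module killed by a power of the maximal ideal is generated by at most as
many elements as its socle. -/
lemma IsLocalRing.exists_span_dual_eq_top [Module.Injective A E] (hfg : (maximalIdeal A).FG) {ε : E}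
    (hε : ∀ a ∈ maximalIdeal A, a • ε = 0)
    (hsoc : ∀ e : E, (∀ a ∈ maximalIdeal A, a • e = 0) → e ∈ A ∙ ε)
    {n : ℕ} (hn : ∀ a ∈ maximalIdeal A ^ n, ∀ d : D, a • d = 0) {r : ℕ} (b : Fin r → D)
    (hb : ∀ i, ∀ a ∈ maximalIdeal A, a • b i = 0)
    (hspan : ∀ d : D, (∀ a ∈ maximalIdeal A, a • d = 0) → d ∈ Submodule.span A (Set.range b)) :
    ∃ s : Set (D →ₗ[A] E), s.Finite ∧ s.ncard ≤ r ∧ Submodule.span A s = ⊤ := by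
  let κ : ResidueField A →ₗ[A] E := (maximalIdeal A).liftQ (LinearMap.toSpanSingleton A E ε)
    fun a ha => hε a ha
  have hκ : ∀ f : D →ₗ[A] E, ∃ w : Fin r → ResidueField A, ∀ i, κ (w i) = f (b i) := by
    intro f
    have : ∀ i, ∃ w, κ w = f (b i) := fun i => by
      obtain ⟨a, ha⟩ := Submodule.mem_span_singleton.mp
        (hsoc (f (b i)) fun a ha => by rw [← map_smul, hb i a ha, map_zero])
      exact ⟨residue A a, ha⟩
    exact ⟨fun i => (this i).choose, fun i => (this i).choose_spec⟩
  -- W records the values of functionals on the socle generators; its dimension is at most r.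
  let W : Submodule (ResidueField A) (Fin r → ResidueField A) :=
    { carrier := {w | ∃ f : D →ₗ[A] E, ∀ i, κ (w i) = f (b i)}
      add_mem' := by
        rintro w w' ⟨f, hf⟩ ⟨f', hf'⟩
        exact ⟨f + f', fun i => by simp [hf, hf']⟩
      zero_mem' := ⟨0, fun i => by simp⟩
      smul_mem' := by
        rintro c w ⟨f, hf⟩
        obtain ⟨a, rfl⟩ := residue_surjective c
        refine ⟨a • f, fun i => ?_⟩
        rw [LinearMap.smul_apply, ← hf, ← map_smul]
        rfl }
  let B := Module.finBasis (ResidueField A) W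
  have hBW : ∀ j, ∃ f : D →ₗ[A] E, ∀ i, κ ((B j : Fin r → ResidueField A) i) = f (b i) :=
    fun j => (B j).2
  choose F hF using hBW
  refine ⟨Set.range F, Set.finite_range F, ?_, ?_⟩
  · rw [← Set.image_univ]
    refine (Set.ncard_image_le Set.finite_univ).trans ?_
    rw [Set.ncard_univ, Nat.card_eq_fintype_card, Fintype.card_fin]
    exact (Submodule.finrank_le W).trans_eq (Module.finrank_fin_fun _)
  have key : ⊤ ≤ Submodule.span A (Set.range F) ⊔ maximalIdeal A • (⊤ : Submodule A (D →ₗ[A] E)) := by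
    intro f _
    obtain ⟨w, hw⟩ := hκ f
    let w' : W := ⟨w, f, hw⟩
    choose a ha using fun j => residue_surjective (B.repr w' j)
    have hw' : ∀ i, w i = ∑ j, a j • (B j : Fin r → ResidueField A) i := by
      intro i
      have := congrArg (fun z : W => (z : Fin r → ResidueField A) i) (B.sum_repr w').symm
      simp only [w', Submodule.coe_sum, Finset.sum_apply, Submodule.coe_smul, Pi.smul_apply] at this
      rw [this]
      refine Finset.sum_congr rfl fun j _ => ?_
      rw [← ha j]
      rfl
    rw [← sub_add_cancel f (∑ j, a j • F j), add_comm]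
    refine Submodule.add_mem_sup (Submodule.sum_mem _ fun j _ => Submodule.smul_mem _ _
      (Submodule.subset_span ⟨j, rfl⟩)) ?_
    refine Module.Injective.mem_smul_top_of_vanish hfg _ fun d hd => ?_
    have hle : Submodule.span A (Set.range b) ≤ LinearMap.ker (f - ∑ j, a j • F j) := by
      rw [Submodule.span_le]
      rintro _ ⟨i, rfl⟩
      simp only [SetLike.mem_coe, LinearMap.mem_ker, LinearMap.sub_apply, LinearMap.sum_apply,
        LinearMap.smul_apply, ← hF, ← hw, hw' i, map_sum, map_smul, sub_self]
    exact hle (hspan d hd)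
  -- Nakayama for an ideal acting nilpotently, which needs no prior finiteness of the dual.
  have hpow : ∀ k, ⊤ ≤ Submodule.span A (Set.range F) ⊔
      maximalIdeal A ^ k • (⊤ : Submodule A (D →ₗ[A] E)) := by
    intro k
    induction k with
    | zero => simp
    | succ k ih =>
      refine ih.trans (sup_le le_sup_left ((Submodule.smul_mono le_rfl key).trans ?_))
      rw [Submodule.smul_sup, pow_succ, Submodule.mul_smul]
      exact sup_le_sup_right Submodule.smul_le_right _
  have hzero : maximalIdeal A ^ n • (⊤ : Submodule A (D →ₗ[A] E)) = ⊥ := by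
    rw [eq_bot_iff, Submodule.smul_le]
    intro a ha f _
    rw [Submodule.mem_bot]
    ext d
    rw [LinearMap.smul_apply, ← map_smul, hn a ha d, map_zero, LinearMap.zero_apply]
  have := hpow n
  rw [hzero, sup_bot_eq] at this
  exact top_le_iff.mp this

/-- If `c` kills the `X`-torsion of a module `D` of finite length with socle generated by `r`
elements, then `c ^ r` annihilates `D` up to `X`. -/
lemma IsLocalRing.pow_mem_sup_of_smul_torsion_eq_zero [IsNoetherianRing A] {n : ℕ}
    (hn : ∀ a ∈ maximalIdeal A ^ n, ∀ d : D, a • d = 0) {r : ℕ} (b : Fin r → D)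
    (hb : ∀ i, ∀ a ∈ maximalIdeal A, a • b i = 0)
    (hspan : ∀ d : D, (∀ a ∈ maximalIdeal A, a • d = 0) → d ∈ Submodule.span A (Set.range b))
    {X I : Ideal A} {c : A} (hc : ∀ d : D, (∀ x ∈ X, x • d = 0) → c • d = 0)
    (hI : ∀ a : A, (∀ d : D, a • d = 0) → a ∈ I) : c ^ r ∈ X ⊔ I := by
  obtain ⟨E, _, _, ε, hE, hε0, hε, hsoc⟩ := exists_injective_hull_residueField A
  obtain ⟨s, hs, hsr, hst⟩ := exists_span_dual_eq_top (IsNoetherian.noetherian _) hε hsoc hn b hb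
    hspan
  have : Module.Finite A (D →ₗ[A] E) := ⟨Submodule.fg_def.mpr ⟨s, hs, hst⟩⟩
  -- Since c • f vanishes on the X-torsion, c maps the dual into X times itself, and Cayley–Hamilton
  -- applies.
  obtain ⟨p, hp, hdeg, hcoeff, hp0⟩ :=
    LinearMap.exists_monic_and_natDegree_eq_and_coeff_mem_pow_and_aeval_eq_zero A
      (c • (LinearMap.id : (D →ₗ[A] E) →ₗ[A] (D →ₗ[A] E))) X (by
        rintro _ ⟨f, rfl⟩
        refine Module.Injective.mem_smul_top_of_vanish (IsNoetherian.noetherian _) _ fun d hd => ?_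
        change c • f d = 0
        rw [← map_smul, hc d hd, map_zero])
  have hpc : p.eval c ∈ I := by
    refine hI _ fun d => by_contra fun hd => ?_
    obtain ⟨f, hf⟩ := Module.Injective.exists_apply_eq (E := E) hε hd
    refine hε0 ?_
    have h1 : c • (LinearMap.id : (D →ₗ[A] E) →ₗ[A] (D →ₗ[A] E)) =
      algebraMap A (Module.End A (D →ₗ[A] E)) c := rfl
    rw [h1, Polynomial.aeval_algebraMap_apply] at hp0
    have h2 := LinearMap.congr_fun (LinearMap.congr_fun hp0 f) d
    rw [← hf, map_smul]
    simpa using h2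
  have hle : p.natDegree ≤ r := by
    rw [hdeg, ← hst]
    exact (Submodule.spanFinrank_span_le_ncard_of_finite hs).trans hsr
  suffices c ^ p.natDegree ∈ X ⊔ I by
    rw [← Nat.sub_add_cancel hle, pow_add]
    exact Ideal.mul_mem_left _ _ this
  rw [Polynomial.eval_eq_sum_range, Finset.sum_range_succ, hp.coeff_natDegree, one_mul] at hpc
  rw [← add_sub_cancel_left (∑ i ∈ Finset.range p.natDegree, p.coeff i * c ^ i)
    (c ^ p.natDegree)]
  refine Ideal.sub_mem _ (Ideal.mem_sup_right hpc) (Ideal.mem_sup_left ?_)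
  refine Ideal.sum_mem _ fun i hi => Ideal.mul_mem_right _ _ ?_
  exact Ideal.pow_le_self (by have := Finset.mem_range.mp hi; omega) (hcoeff i)

end Matlis

/-! ### Torsion submodules of the first nonvanishing Ext -/

section ExtTorsion

open CategoryTheory Abelian RingTheory.Sequence

variable {A : Type u} [CommRing A]

/-- In the degree given by the length of a weakly regular sequence, `Ext` takes surjections between
modules on which the sequence acts nilpotently to injections. -/
lemma RingTheory.Sequence.IsWeaklyRegular.ext_eq_zero_of_comp_eq_zero {M : ModuleCat.{u} A}
    {rs : List A} (hrs : IsWeaklyRegular M rs) {X Y : Type u} [AddCommGroup X] [Module A X]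
    [AddCommGroup Y] [Module A Y] (hX : ∀ x ∈ rs, ∃ l : ℕ, ∀ t : X, x ^ l • t = 0)
    {f : X →ₗ[A] Y} (hf : Function.Surjective f) (e : Ext (ModuleCat.of A Y) M rs.length)
    (he : (Ext.mk₀ (ModuleCat.ofHom f)).comp e (zero_add _) = 0) : e = 0 := by
  generalize hn : rs.length = n at e he
  cases n with
  | zero =>
    have : Epi (ModuleCat.ofHom f) := (ModuleCat.epi_iff_surjective _).mpr hf
    exact Ext.precomp_mk₀_injective_of_epi M (ModuleCat.ofHom f) (he.trans (map_zero _).symm)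
  | succ n =>
    obtain ⟨e₁, rfl⟩ := Ext.contravariant_sequence_exact₃ (LinearMap.shortExact_shortComplexKer hf)
      M e he (add_comm 1 n)
    have : e₁ = 0 := hrs.ext_eq_zero (T := ModuleCat.of A (LinearMap.ker f))
      (fun x hx => (hX x hx).imp fun l hl t => Subtype.ext (hl t)) (by omega) e₁
    rw [this]
    exact Ext.comp_zero ..

/-- A class in `Ext (A ⧸ I) M n` which is killed by an ideal `J ≥ I` comes from
`Ext (A ⧸ J) M n`. -/
lemma RingTheory.Sequence.IsWeaklyRegular.exists_comp_factor_eq {M : ModuleCat.{u} A}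
    {rs : List A} (hrs : IsWeaklyRegular M rs) {I J : Ideal A} (hIJ : I ≤ J) (hJ : J.FG)
    (hI : ∀ x ∈ rs, ∃ l : ℕ, x ^ l ∈ I) (d : Ext (ModuleCat.of A (A ⧸ I)) M rs.length)
    (hd : ∀ j ∈ J, j • d = 0) :
    ∃ d' : Ext (ModuleCat.of A (A ⧸ J)) M rs.length,
      (Ext.mk₀ (ModuleCat.ofHom (Submodule.factor hIJ))).comp d' (zero_add _) = d := by
  classical
  obtain ⟨s, hs⟩ := hJ
  have hS := LinearMap.shortExact_shortComplexKer (Submodule.factor_surjective hIJ)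
  refine Ext.contravariant_sequence_exact₂ hS M d ?_
  have hsJ : ∀ j : s, (j : A) ∈ J := fun j => hs ▸ Ideal.subset_span j.2
  -- This maps onto J/I. The pullback of d along it is a sum of multiples j • d = 0, and pullback
  -- along a surjection is injective here, so d vanishes on J/I.
  let q' : (s → A ⧸ I) →ₗ[A] (A ⧸ I) := ∑ j : s, (j : A) • LinearMap.proj j
  have hq' : ∀ x, q' x ∈ LinearMap.ker (Submodule.factor hIJ) := by
    intro x
    rw [LinearMap.mem_ker, LinearMap.sum_apply, map_sum]
    refine Finset.sum_eq_zero fun j _ => ?_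
    rw [LinearMap.smul_apply, map_smul]
    obtain ⟨y, hy⟩ := Ideal.Quotient.mk_surjective (Submodule.factor hIJ (x j))
    change (j : A) • (Submodule.factor hIJ (x j) : A ⧸ J) = 0
    rw [← hy]
    exact Ideal.Quotient.eq_zero_iff_mem.mpr (J.mul_mem_right y (hsJ j))
  let q : (s → A ⧸ I) →ₗ[A] LinearMap.ker (Submodule.factor hIJ) := q'.codRestrict _ hq'
  have hq : Function.Surjective q := by
    rintro ⟨x, hx⟩
    obtain ⟨y, rfl⟩ := Submodule.Quotient.mk_surjective _ x
    have hy : y ∈ Ideal.span (s : Set A) := by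
      rw [hs]
      exact (Submodule.Quotient.mk_eq_zero J).mp hx
    have hrange : Ideal.span (s : Set A) ≤ (LinearMap.range q').comap (Submodule.mkQ I) := by
      rw [Ideal.span_le]
      intro j hj
      refine ⟨Pi.single ⟨j, hj⟩ (Submodule.Quotient.mk 1), ?_⟩
      rw [LinearMap.sum_apply, Finset.sum_eq_single ⟨j, hj⟩]
      · simp only [LinearMap.smul_apply, LinearMap.proj_apply, Pi.single_eq_same,
          Submodule.mkQ_apply, ← Submodule.Quotient.mk_smul, smul_eq_mul, mul_one]
      · intro b _ hb
        rw [LinearMap.smul_apply, LinearMap.proj_apply, Pi.single_eq_of_ne hb, smul_zero]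
      · exact fun h => (h (Finset.mem_univ _)).elim
    obtain ⟨z, hz⟩ := hrange hy
    exact ⟨z, Subtype.ext hz⟩
  refine hrs.ext_eq_zero_of_comp_eq_zero (fun x hx => ?_) hq _ ?_
  · obtain ⟨l, hl⟩ := hI x hx
    refine ⟨l, fun t => funext fun j => ?_⟩
    obtain ⟨y, hy⟩ := Ideal.Quotient.mk_surjective (t j)
    rw [Pi.smul_apply, Pi.zero_apply, ← hy]
    exact Ideal.Quotient.eq_zero_iff_mem.mpr (I.mul_mem_right y hl)
  · have hcomp : ModuleCat.ofHom q ≫ ModuleCat.ofHom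
        (LinearMap.ker (Submodule.factor hIJ)).subtype =
        ∑ j : s, ModuleCat.ofHom (LinearMap.proj (R := A) (φ := fun _ : s => A ⧸ I) j) ≫
          ((j : A) • 𝟙 (ModuleCat.of A (A ⧸ I))) := by
      ext x
      rw [ModuleCat.hom_sum]
      simp [q, q']
    refine (Ext.mk₀_comp_mk₀_assoc ..).trans ?_
    refine (congrArg (fun z => (Ext.mk₀ z).comp d (zero_add _)) hcomp).trans ?_
    rw [Ext.mk₀_sum, Ext.sum_comp]
    refine Finset.sum_eq_zero fun j _ => ?_
    rw [← Ext.mk₀_comp_mk₀_assoc, Ext.mk₀_smul, Ext.smul_comp, Ext.mk₀_id_comp, hd j (hsJ j),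
      Ext.comp_zero]

end ExtTorsion

/-! ### The local case: `rs` generates an 𝔪-primary ideal -/

section Local

open CategoryTheory Abelian RingTheory.Sequence

open IsLocalRing

variable {A : Type u} [CommRing A] [IsNoetherianRing A]

/-- The ascending chain of ideals (X : m^n) stabilises; thus one power of m kills all m-power
torsion of A/X. -/
lemma Ideal.exists_forall_mul_mem_of_forall_pow_mul_mem (m X : Ideal A) :
    ∃ e : ℕ, ∀ (y : A) (n : ℕ), (∀ a ∈ m ^ n, a * y ∈ X) → ∀ c ∈ m ^ e, c * y ∈ X := by
  let N : ℕ →o Ideal A :=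
    { toFun := fun n => X.colon ((m ^ n : Ideal A) : Set A)
      monotone' := fun i j hij => Submodule.colon_mono le_rfl (Ideal.pow_le_pow_right hij) }
  obtain ⟨e, he⟩ := monotone_stabilizes_iff_noetherian.mpr ‹IsNoetherianRing A› N
  refine ⟨e, fun y n hy c hc => ?_⟩
  have hyn : y ∈ N n := Submodule.mem_colon.mpr fun a ha => by
    rw [smul_eq_mul, mul_comm]; exact hy a ha
  have hye : y ∈ N e := by
    rcases le_total n e with h | h
    · exact N.monotone h hyn
    · rw [he n h]; exact hyn
  have := Submodule.mem_colon.mp hye c hc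
  rwa [smul_eq_mul, mul_comm] at this

variable [IsLocalRing A]

lemma IsLocalRing.mem_of_forall_mem_sup_pow (X : Ideal A) {c : A}
    (hc : ∀ n, c ∈ X ⊔ maximalIdeal A ^ n) : c ∈ X := by
  have h := Ideal.iInf_pow_smul_eq_bot_of_isLocalRing (M := A ⧸ X) (maximalIdeal A)
    (Ideal.IsPrime.ne_top inferInstance)
  rw [← Ideal.Quotient.eq_zero_iff_mem, ← Submodule.mem_bot A, ← h, Submodule.mem_iInf]
  intro n
  obtain ⟨x, hx, y, hy, rfl⟩ := Submodule.mem_sup.mp (hc n)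
  rw [map_add, Ideal.Quotient.eq_zero_iff_mem.mpr hx, zero_add, ← mul_one y]
  exact Submodule.smul_mem_smul (N := (⊤ : Submodule A (A ⧸ X))) hy
    (Submodule.mem_top (x := Ideal.Quotient.mk X 1))

/-- Let `I` be a family of `𝔪`-primary ideals of a Noetherian local ring `A`, cofinal with the
powers of `𝔪`, and let `rs` be a weakly regular sequence in `𝔪` of length `n`. If all the modules
`Ext (A ⧸ I k) A n` are faithful over `A ⧸ I k`, then `rs` generates an `𝔪`-primary ideal. -/
theorem IsLocalRing.maximalIdeal_le_radical_ofList_of_faithful_ext {rs : List A}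
    (hrs : IsWeaklyRegular A rs) (hmem : ∀ x ∈ rs, x ∈ maximalIdeal A) (I : ℕ → Ideal A)
    (hI : ∀ k, I k ≤ maximalIdeal A) (hpow : ∀ k, ∃ n, maximalIdeal A ^ n ≤ I k)
    (hcof : ∀ n, ∃ k, I k ≤ maximalIdeal A ^ n)
    (hfaith : ∀ k (c : A), (∀ e : Ext (ModuleCat.of A (A ⧸ I k)) (ModuleCat.of A A) rs.length,
      c • e = 0) → c ∈ I k) :
    maximalIdeal A ≤ (Ideal.ofList rs).radical := by
  set X : Ideal A := (Ideal.ofList rs • ⊤ : Submodule A A) with hX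
  have hX' : X = Ideal.ofList rs := by rw [hX, smul_eq_mul, Ideal.mul_top]
  rw [← hX']
  -- Both r and the exponent e below are chosen before k, which makes the final bound uniform in k.
  obtain ⟨r, g, hg⟩ := Module.Finite.exists_fin (R := A)
    (M := Ext (ModuleCat.of A (A ⧸ maximalIdeal A)) (ModuleCat.of A A) rs.length)
  obtain ⟨e, he⟩ := (maximalIdeal A).exists_forall_mul_mem_of_forall_pow_mul_mem X
  have hsmul : ∀ (J : Ideal A) (j : A), j ∈ J → ∀ t : A ⧸ J, j • t = 0 := by
    intro J j hj t
    obtain ⟨y, rfl⟩ := Ideal.Quotient.mk_surjective t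
    exact Ideal.Quotient.eq_zero_iff_mem.mpr (J.mul_mem_right y hj)
  have key : ∀ c ∈ maximalIdeal A ^ e, c ^ r ∈ X := by
    intro c hc
    refine mem_of_forall_mem_sup_pow X fun n => ?_
    obtain ⟨k, hk⟩ := hcof n
    refine sup_le_sup_left hk X ?_
    obtain ⟨l, hl⟩ := hpow k
    have hmem' : ∀ x ∈ rs, ∃ l, x ^ l ∈ I k := fun x hx =>
      ⟨l, hl (Ideal.pow_mem_pow (hmem x hx) l)⟩
    have hann : ∀ j ∈ I k, ∀ d : Ext (ModuleCat.of A (A ⧸ I k)) (ModuleCat.of A A) rs.length,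
        j • d = 0 := fun j hj d => Ext.smul_eq_zero_of_forall_smul_eq_zero (hsmul _ j hj) d
    refine pow_mem_sup_of_smul_torsion_eq_zero
      (D := Ext (ModuleCat.of A (A ⧸ I k)) (ModuleCat.of A A) rs.length) (n := l)
      (fun a ha d => hann a (hl ha) d)
      (fun i => (Ext.mk₀ (ModuleCat.ofHom (Submodule.factor (hI k)))).comp (g i) (zero_add _))
      ?_ ?_ ?_ (hfaith k)
    · intro i a ha
      rw [← Ext.comp_smul, Ext.smul_eq_zero_of_forall_smul_eq_zero (hsmul _ a ha), Ext.comp_zero]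
    · intro d hd
      obtain ⟨d', rfl⟩ := hrs.exists_comp_factor_eq (hI k) (IsNoetherian.noetherian _) hmem' d hd
      have hd' : d' ∈ Submodule.span A (Set.range g) := hg ▸ Submodule.mem_top
      clear hd
      induction hd' using Submodule.span_induction with
      | mem x hx =>
        obtain ⟨i, rfl⟩ := hx
        exact Submodule.subset_span ⟨i, rfl⟩
      | zero => rw [Ext.comp_zero]; exact zero_mem _
      | add x y _ _ hx hy => rw [Ext.comp_add]; exact add_mem hx hy
      | smul a x _ hx => rw [Ext.comp_smul]; exact Submodule.smul_mem _ a hx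
    · intro d hd
      obtain ⟨d', rfl⟩ := hrs.exists_comp_factor_eq (le_sup_left : I k ≤ I k ⊔ X)
        (IsNoetherian.noetherian _) hmem' d (fun j hj => by
          obtain ⟨x, hx, y, hy, rfl⟩ := Submodule.mem_sup.mp hj
          rw [add_smul, hann x hx, hd y hy, add_zero])
      rw [← Ext.comp_smul, hrs.smul_ext_eq_zero (T := ModuleCat.of A (A ⧸ (I k ⊔ X)))
        (M := ModuleCat.of A A) ?_ ?_ d', Ext.comp_zero]
      · intro x hx t
        refine hsmul (I k ⊔ X) x (Ideal.mem_sup_right ?_) t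
        rw [hX']
        exact Ideal.subset_span hx
      -- The image of f is killed by I k, hence by a power of 𝔪, hence by c ∈ 𝔪^e.
      · intro f
        refine LinearMap.ext fun t => ?_
        obtain ⟨y, hy⟩ := Submodule.Quotient.mk_surjective _ (f t)
        rw [LinearMap.smul_apply, ← hy, ← Submodule.Quotient.mk_smul]
        refine (Submodule.Quotient.mk_eq_zero _).mpr (he y l (fun a ha => ?_) c hc)
        refine (Submodule.Quotient.mk_eq_zero X).mp ?_
        rw [← smul_eq_mul, Submodule.Quotient.mk_smul]
        refine (congrArg (a • ·) hy).trans ?_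
        rw [← map_smul]
        refine (congrArg f (hsmul (I k ⊔ X) a (Ideal.mem_sup_left (hl ha)) t)).trans (map_zero _)
  intro c hc
  exact ⟨e * r, by rw [pow_mul]; exact key _ (Ideal.pow_mem_pow hc e)⟩

end Local

/-! ### Grade and height -/

section Grade

open CategoryTheory RingTheory.Sequence

variable {R : Type u} [CommRing R]

lemma Ideal.IsPerfect.ne_top {a : Ideal R} (ha : a.IsPerfect) : a ≠ ⊤ := by
  rintro rfl
  have : Subsingleton (R ⧸ (⊤ : Ideal R)) := Ideal.Quotient.subsingleton_iff.mpr rfl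
  have h : projectiveDimension (ModuleCat.of R (R ⧸ (⊤ : Ideal R))) = ⊥ :=
    (projectiveDimension_eq_bot_iff _).mpr (ModuleCat.isZero_of_subsingleton _)
  rw [Ideal.IsPerfect, h] at ha
  exact WithBot.bot_ne_coe ha

variable [IsNoetherianRing R]

/-- At each minimal prime of `a` the sequence becomes regular and lowers the dimension of the local
ring by its length. -/
lemma RingTheory.Sequence.IsWeaklyRegular.length_le_height {rs : List R}
    (hrs : IsWeaklyRegular R rs) {a : Ideal R} (hmem : ∀ x ∈ rs, x ∈ a) :
    (rs.length : ℕ∞) ≤ a.height := by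
  rw [a.height_eq_inf_minimalPrimes]
  refine le_iInf₂ fun p hp => ?_
  have := hp.isPrime
  have hreg := hrs.isRegular_of_isLocalization_of_mem (Localization.AtPrime p) p
    fun x hx => hp.le (hmem x hx)
  have hdim := ringKrullDim_add_length_eq_ringKrullDim_of_isRegular _ hreg
  have hne : Ideal.ofList (rs.map (algebraMap R (Localization.AtPrime p))) ≠ ⊤ := by
    have := hreg.2.symm
    rwa [smul_eq_mul, Ideal.mul_top] at this
  have := Ideal.Quotient.nontrivial_iff.mpr hne
  rw [IsLocalization.AtPrime.ringKrullDim_eq_height p (Localization.AtPrime p), List.length_map] at hdim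
  have h0 := add_le_add_left (ringKrullDim_nonneg_of_nontrivial
    (R := Localization.AtPrime p ⧸ Ideal.ofList (rs.map (algebraMap R (Localization.AtPrime p)))))
    (rs.length : WithBot ℕ∞)
  rw [hdim, zero_add] at h0
  exact_mod_cast h0

lemma Ideal.exists_isRegular_length_eq_grade {a : Ideal R} (ha : a ≠ ⊤) :
    ∃ rs : List R, IsRegular R rs ∧ (∀ x ∈ rs, x ∈ a) ∧ (rs.length : ℕ∞) = a.grade := by
  have hgrade : ∀ b : ℕ∞, (∀ rs : List R, IsRegular R rs → (∀ x ∈ rs, x ∈ a) →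
      (rs.length : ℕ∞) ≤ b) → a.grade ≤ b := fun b h =>
    iSup_le fun rs => iSup_le fun h1 => iSup_le fun h2 => h rs h1 h2
  have hle : a.grade ≤ a.height := hgrade _ fun rs hrs hmem => hrs.1.length_le_height hmem
  obtain ⟨g, hg⟩ := ENat.ne_top_iff_exists.mp (hle.trans_lt (Ideal.height_lt_top ha)).ne
  rw [← hg]
  have hlt : ∀ rs : List R, IsRegular R rs → (∀ x ∈ rs, x ∈ a) → rs.length ≤ g := by
    intro rs h1 h2
    have : (rs.length : ℕ∞) ≤ a.grade :=
      le_iSup_of_le rs (le_iSup_of_le h1 (le_iSup_of_le h2 le_rfl))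
    rw [← hg] at this
    exact_mod_cast this
  by_contra hne
  have hlt' : ∀ rs : List R, IsRegular R rs → (∀ x ∈ rs, x ∈ a) → rs.length < g :=
    fun rs h1 h2 => (hlt rs h1 h2).lt_of_ne fun h => hne ⟨rs, h1, h2, by rw [h]⟩
  have : Nontrivial R := ⟨0, 1, fun h => ha ((Ideal.eq_top_iff_one a).mpr (h ▸ a.zero_mem))⟩
  -- The empty sequence rules out g = 0, so that g - 1 is a genuine predecessor.
  have hg0 : 0 < g := hlt' [] (IsRegular.nil R R) (by simp)
  have hg1 : a.grade ≤ ((g - 1 : ℕ) : ℕ∞) := hgrade _ fun rs hrs hmem => by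
    have := hlt' rs hrs hmem
    exact_mod_cast (by omega : rs.length ≤ g - 1)
  rw [← hg] at hg1
  have : g ≤ g - 1 := by exact_mod_cast hg1
  omega

end Grade

/-! ### Bounds for the cohomological dimension -/

section LocalCohomology

open CategoryTheory RingTheory.Sequence

variable {R : Type u} [CommRing R]

lemma isZero_localCohomology_of_hasProjectiveDimensionLE {a : Ideal R} {I : ℕ → Ideal R}
    (hI : Ideal.AreCofinal I (fun k => a ^ k)) {g : ℕ}
    (hpd : ∀ k, HasProjectiveDimensionLE (ModuleCat.of R (R ⧸ I k)) g) (M : ModuleCat.{u} R)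
    {i : ℕ} (hi : g < i) : Limits.IsZero ((localCohomology a i).obj M) := by
  refine isZero_localCohomology a M i fun k => ?_
  obtain ⟨l, hl⟩ := hI.2 k
  obtain ⟨n, hn⟩ := hI.1 l
  obtain ⟨j, rfl⟩ := Nat.exists_eq_add_of_lt hi
  refine ⟨max n k, le_max_right n k, ?_⟩
  -- The projection R/a^(max n k) → R/a^k factors through R/I l, whose Ext vanishes above degree g.
  have hle : a ^ max n k ≤ I l := (Ideal.pow_le_pow_right (le_max_left n k)).trans hn
  have hfac : ModuleCat.ofHom (Submodule.factor
      (Ideal.pow_le_pow_right (le_max_right n k) : a ^ max n k ≤ a ^ k)) =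
      ModuleCat.ofHom (Submodule.factor hle) ≫ ModuleCat.ofHom (Submodule.factor hl) := by
    rw [← ModuleCat.ofHom_comp, Submodule.factor_comp]
  have := hpd l
  have : Subsingleton (Abelian.Ext (ModuleCat.of R (R ⧸ I l)) M (g + j + 1)) :=
    HasProjectiveDimensionLT.subsingleton (ModuleCat.of R (R ⧸ I l)) (g + 1) _ (by omega) M
  rw [hfac, op_comp, Functor.map_comp, NatTrans.comp_app]
  rw [(isZero_ext_of_subsingleton (X := ModuleCat.of R (R ⧸ I l)) (Y := M)
    (n := g + j)).eq_of_tgt (((_root_.Ext R (ModuleCat.{u} R) (g + j + 1)).map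
      (ModuleCat.ofHom (Submodule.factor hl)).op).app M) 0, Limits.zero_comp]

/-- The cohomological dimension of `a` is at least any `n` for which `Ext (R ⧸ a) R n ≠ 0` and `a`
contains a weakly regular sequence of length `n`. -/
lemma le_of_isZero_localCohomology {a : Ideal R} {rs : List R} (hrs : IsWeaklyRegular R rs)
    (hmem : ∀ x ∈ rs, x ∈ a)
    (hne : ∃ e : Abelian.Ext (ModuleCat.of R (R ⧸ a)) (ModuleCat.of R R) rs.length, e ≠ 0)
    {c : ℕ} (hc : ∀ (M : ModuleCat.{u} R) (i : ℕ), c < i →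
      Limits.IsZero ((localCohomology a i).obj M)) : rs.length ≤ c := by
  by_contra! h
  rw [← pow_one a] at hne
  obtain ⟨e, he⟩ := hne
  obtain ⟨l, hl, hel⟩ := exists_comp_eq_zero_of_isZero_localCohomology a (ModuleCat.of R R) _
    (hc (ModuleCat.of R R) _ h) 1 e
  refine he (hrs.ext_eq_zero_of_comp_eq_zero (fun x hx => ⟨l, fun t => ?_⟩)
    (Submodule.factor_surjective _) e hel)
  obtain ⟨y, rfl⟩ := Ideal.Quotient.mk_surjective t
  exact Ideal.Quotient.eq_zero_iff_mem.mpr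
    (Ideal.mul_mem_right y _ (Ideal.pow_mem_pow (hmem x hx) l))

end LocalCohomology

/-! ### The height bound -/

section Height

open CategoryTheory RingTheory.Sequence

variable {R : Type u} [CommRing R] [IsNoetherianRing R]

lemma IsLocalRing.height_maximalIdeal_le_length [IsLocalRing R] {rs : List R}
    (hmem : ∀ x ∈ rs, x ∈ maximalIdeal R) (h : maximalIdeal R ≤ (Ideal.ofList rs).radical) :
    (maximalIdeal R).height ≤ rs.length := by
  classical
  have hmin : maximalIdeal R ∈ (Ideal.span (rs.toFinset : Set R)).minimalPrimes := by
    have hspan : Ideal.span (rs.toFinset : Set R) = Ideal.ofList rs := by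
      congr 1; ext; simp
    rw [hspan]
    refine ⟨⟨inferInstance, Ideal.span_le.mpr hmem⟩, fun q hq _ => h.trans ?_⟩
    exact hq.1.radical_le_iff.mpr hq.2
  refine (Ideal.height_le_card_of_mem_minimalPrimes_span_finset hmin).trans ?_
  exact_mod_cast rs.toFinset_card_le

/-- If `R ⧸ a` has projective dimension at most the length of a weakly regular sequence in `a`,
and the images of `a` under a family of endomorphisms are cofinal with the powers of `a`, then the
height of `a` is at most this length. -/
theorem Ideal.height_le_length_of_areCofinal {a : Ideal R} (ha : a ≠ ⊤) {rs : List R}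
    (hrs : IsWeaklyRegular R rs) (hmem : ∀ x ∈ rs, x ∈ a)
    (hpd : HasProjectiveDimensionLE (ModuleCat.of R (R ⧸ a)) rs.length) (φ : ℕ → R →+* R)
    (hle : ∀ k, a.map (φ k) ≤ a)
    (hcof : Ideal.AreCofinal (fun k => a.map (φ k)) (fun k => a ^ k)) :
    a.height ≤ rs.length := by
  obtain ⟨p, hp⟩ := Ideal.nonempty_minimalPrimes ha
  have := hp.isPrime
  refine (Ideal.height_mono hp.le).trans ?_
  let A := Localization.AtPrime p
  let ι := algebraMap R A
  have hap : a.map ι ≤ IsLocalRing.maximalIdeal A := by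
    rw [← Localization.AtPrime.map_eq_maximalIdeal]
    exact Ideal.map_mono hp.le
  have hlen : (rs.map ι).length = rs.length := List.length_map _
  have hreg : IsWeaklyRegular A (rs.map ι) := hrs.of_isLocalization A p.primeCompl
  have hmemA : ∀ x ∈ rs.map ι, x ∈ IsLocalRing.maximalIdeal A := by
    intro x hx
    obtain ⟨y, hy, rfl⟩ := List.mem_map.mp hx
    exact hap (Ideal.mem_map_of_mem ι (hmem y hy))
  have hmap : ∀ k, a.map (ι.comp (φ k)) = (a.map (φ k)).map ι := fun k => (Ideal.map_map _ _).symm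
  obtain ⟨N, hN⟩ : ∃ N, IsLocalRing.maximalIdeal A ^ N ≤ a.map ι := by
    refine Ideal.exists_pow_le_of_le_radical_of_fg ?_ (IsNoetherian.noetherian _)
    rw [IsLocalization.AtPrime.radical_map_of_mem_minimalPrimes A p a hp,
      Localization.AtPrime.map_eq_maximalIdeal]
  have hrad := IsLocalRing.maximalIdeal_le_radical_ofList_of_faithful_ext hreg hmemA
    (fun k => a.map (ι.comp (φ k))) (fun k => ?_) (fun k => ?_) (fun n => ?_) (fun k c hc => ?_)
  · have := IsLocalRing.height_maximalIdeal_le_length hmemA hrad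
    have hdim := (IsLocalRing.maximalIdeal_height_eq_ringKrullDim (R := A)).trans
      (IsLocalization.AtPrime.ringKrullDim_eq_height p A)
    rwa [hlen, WithBot.coe_injective hdim] at this
  · rw [hmap]
    exact (Ideal.map_mono (hle k)).trans hap
  · obtain ⟨l, hl⟩ := hcof.1 k
    refine ⟨N * l, ?_⟩
    rw [hmap, pow_mul]
    refine (Ideal.pow_right_mono hN l).trans ?_
    rw [← Ideal.map_pow]
    exact Ideal.map_mono hl
  · obtain ⟨k, hk⟩ := hcof.2 n
    refine ⟨k, ?_⟩
    rw [hmap]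
    refine (Ideal.map_mono hk).trans ?_
    rw [Ideal.map_pow]
    exact Ideal.pow_right_mono hap n
  -- The base change is along the composite R → R → A, so R/a needs a finite resolution only over
  -- the source.
  · refine (Ideal.quotient_map_of_isWeaklyRegular (ι.comp (φ k)) hreg (fun x hx => ?_)
      (hlen ▸ hpd)).2 c hc
    obtain ⟨y, hy, rfl⟩ := List.mem_map.mp hx
    obtain ⟨l, hl⟩ := hcof.1 k
    refine ⟨l, ?_⟩
    rw [hmap, ← map_pow]
    exact Ideal.mem_map_of_mem ι (hl (Ideal.pow_mem_pow (hmem y hy) l))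

end Height

theorem lemma2p1 {R : Type u} [CommRing R] [IsNoetherianRing R] (a : Ideal R)
    (ha : a.IsPerfect) (φ : ℕ → R →+* R) (hφ_zero : φ 0 = RingHom.id R)
    (hφ_anti : ∀ i j : ℕ, j ≤ i → φ i '' (a : Set R) ⊆ φ j '' (a : Set R))
    (hφ_cofinal : Ideal.AreCofinal (fun k => a.map (φ k)) (fun k => a ^ k)) :
    a.cohomologicalDimension = a.height := by
  obtain ⟨rs, hrs, hmem, hlen⟩ := Ideal.exists_isRegular_length_eq_grade ha.ne_top
  have hpd : CategoryTheory.HasProjectiveDimensionLE (ModuleCat.of R (R ⧸ a)) rs.length := by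
    rw [← CategoryTheory.projectiveDimension_le_iff, ha, ← hlen]
    rfl
  have hle : ∀ k, a.map (φ k) ≤ a := by
    intro k
    refine Ideal.map_le_iff_le_comap.mpr fun x hx => ?_
    obtain ⟨y, hy, hxy⟩ := hφ_anti k 0 (Nat.zero_le k) ⟨x, hx, rfl⟩
    rw [Ideal.mem_comap, ← hxy, hφ_zero]
    exact hy
  have hmem' : ∀ k, ∀ x ∈ rs, ∃ l : ℕ, x ^ l ∈ a.map (φ k) := fun k x hx =>
    (hφ_cofinal.1 k).imp fun l hl => hl (Ideal.pow_mem_pow (hmem x hx) l)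
  have hheight : a.height = rs.length :=
    (Ideal.height_le_length_of_areCofinal ha.ne_top hrs.1 hmem hpd φ hle hφ_cofinal).antisymm
      (hrs.1.length_le_height hmem)
  rw [hheight]
  refine le_antisymm (iInf₂_le rs.length fun M i hi => ?_) (le_iInf₂ fun c hc => ?_)
  · exact isZero_localCohomology_of_hasProjectiveDimensionLE hφ_cofinal
      (fun k => (Ideal.quotient_map_of_isWeaklyRegular (φ k) hrs.1 (hmem' k) hpd).1) M hi
  · refine Nat.cast_le.mpr (le_of_isZero_localCohomology hrs.1 hmem ?_ hc)
    by_contra! h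
    -- If the top Ext were zero, then c = 1 would annihilate it, and faithfulness would put 1 in
    -- `a`.
    have h1 := (Ideal.quotient_map_of_isWeaklyRegular (RingHom.id R) hrs.1
      (fun x hx => ⟨1, by rw [Ideal.map_id, pow_one]; exact hmem x hx⟩) hpd).2 1
    rw [Ideal.map_id] at h1
    exact ha.ne_top ((Ideal.eq_top_iff_one a).mpr (h1 fun e => by rw [h e, smul_zero]))
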